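/- For a finite simple graph $\Gamma$ with vertex set $V$, the right-angled Coxeter group defined by $\Gamma$ is the group $$W_\Gamma = \langle V \mid v^2 = 1 \text{ for all } v \in V,\ vw = wv \text{ whenever } v \text{ and } w \text{ are adjacent in } \Gamma \rangle .$$ **Corollary (rigidity of right-angled Coxeter groups).** The defining graph of a right-angled Coxeter group is unique up to isomorphism: if $\Gamma$ and $\Lambda$ are finite simple graphs such that the groups $W_\Gamma$ and $W_\Lambda$ are isomorphic, then the graphs $\Gamma$ and $\Lambda$ are isomorphic. -/

import Mathlib

namespace SimpleGraph

universe u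

/-- The defining relators of the right-angled Coxeter group of a simple graph `Γ`, in the free
group on its vertices: the square of each vertex, and the commutator of each pair of adjacent
vertices. -/
inductive RACGRelator {V : Type u} (Γ : SimpleGraph V) : FreeGroup V → Prop
  | square (v : V) : RACGRelator Γ (FreeGroup.of v ^ 2)
  | commutator {v w : V} (h : Γ.Adj v w) : RACGRelator Γ 
      (FreeGroup.of v * FreeGroup.of w * (FreeGroup.of v)⁻¹ * (FreeGroup.of w)⁻¹)

/-- The right-angled Coxeter group `W_Γ = ⟨V | v² = 1 for v ∈ V, vw = wv for v adjacent to w⟩`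
defined by a simple graph `Γ` with vertex set `V`. -/
abbrev RightAngledCoxeterGroup {V : Type u} (Γ : SimpleGraph V) : Type u :=
  PresentedGroup {r : FreeGroup V | RACGRelator Γ r}

end SimpleGraph

/-! Counting generators mod 2 maps `W_Γ` to `F₂^V`, and the vectors of elements with `x² = 1` are
exactly those supported on cliques. An isomorphism of groups thus gives a linear isomorphism
preserving clique supported vectors. It need not respect the standard bases, but it matches the
maximal subspaces of such vectors, which are coordinate subspaces. The dimension of an intersection
of these counts the vertices common to all of them; inverting these counts gives a bijection of
vertices preserving membership. Adjacency means lying in a common maximal one, so the bijection is a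
graph isomorphism. -/

namespace SimpleGraph

/-! ### The group and its parity vectors. -/

namespace RightAngledCoxeterGroup

variable {V : Type*}

/-- A map from the vertices to a group extends to the right-angled Coxeter group if it takes
vertices to elements squaring to one, and adjacent vertices to commuting elements. -/
def lift {Γ : SimpleGraph V} {G : Type*} [Group G] (f : V → G) (hf : ∀ v, f v ^ 2 = 1)
    (hc : ∀ v w, Γ.Adj v w → Commute (f v) (f w)) : Γ.RightAngledCoxeterGroup →* G :=
  PresentedGroup.toGroup (f := f) <| by
    rintro r (⟨v⟩ | ⟨h⟩)
    · simpa using hf v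
    · simp [(hc _ _ h).eq]

/-- The generator of the right-angled Coxeter group given by a vertex. -/
def of (Γ : SimpleGraph V) (v : V) : Γ.RightAngledCoxeterGroup := PresentedGroup.of v

variable {Γ : SimpleGraph V}

@[simp]
theorem lift_of {G : Type*} [Group G] (f : V → G) (hf : ∀ v, f v ^ 2 = 1)
    (hc : ∀ v w, Γ.Adj v w → Commute (f v) (f w)) (v : V) : lift f hf hc (of Γ v) = f v :=
  PresentedGroup.toGroup.of _

theorem hom_ext {G : Type*} [Group G] {f g : Γ.RightAngledCoxeterGroup →* G}
    (h : ∀ v, f (of Γ v) = g (of Γ v)) : f = g :=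
  PresentedGroup.ext h

theorem of_sq (v : V) : of Γ v ^ 2 = 1 :=
  PresentedGroup.one_of_mem (rels := {r | RACGRelator Γ r}) (RACGRelator.square v)

theorem commute_of {v w : V} (h : Γ.Adj v w) : Commute (of Γ v) (of Γ w) := by
  have := PresentedGroup.one_of_mem (rels := {r | RACGRelator Γ r}) (RACGRelator.commutator h)
  have h' : of Γ v * of Γ w * (of Γ v)⁻¹ * (of Γ w)⁻¹ = 1 := this
  rw [mul_inv_eq_one, mul_inv_eq_iff_eq_mul] at h'
  exact h'

open scoped Classical in
/-- The homomorphism recording, for each vertex, the parity of the number of its occurrences. -/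
noncomputable def parityHom (Γ : SimpleGraph V) :
    Γ.RightAngledCoxeterGroup →* Multiplicative (V → ZMod 2) :=
  lift (fun v => Multiplicative.ofAdd (Pi.single v 1))
    (fun v => by rw [← ofAdd_nsmul, two_nsmul, ← Pi.single_add, CharTwo.add_self_eq_zero,
      Pi.single_zero, ofAdd_zero])
    fun _ _ _ => Commute.all _ _

/-- The parity vector of an element of the right-angled Coxeter group. -/
noncomputable def parity (x : Γ.RightAngledCoxeterGroup) : V → ZMod 2 := (parityHom Γ x).toAdd

open scoped Classical in
@[simp]
theorem parity_of (v : V) : parity (of Γ v) = Pi.single v 1 := by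
  simp [parity, parityHom]

@[simp]
theorem parity_one : parity (1 : Γ.RightAngledCoxeterGroup) = 0 := by
  simp [parity]

@[simp]
theorem parity_mul (x y : Γ.RightAngledCoxeterGroup) : parity (x * y) = parity x + parity y := by
  simp [parity]

end RightAngledCoxeterGroup

/-! ### Involutions and cliques. -/

open RightAngledCoxeterGroup

variable {V V' : Type*}

/-- A vector is clique supported if any two distinct vertices in its support are adjacent. -/
def CliqueSupported (Γ : SimpleGraph V) (u : V → ZMod 2) : Prop :=
  Γ.IsClique (Function.support u)

variable {Γ : SimpleGraph V} {Λ : SimpleGraph V'}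

/-- The two characters of the dihedral group of order eight taking the values `1, 0` and `0, 1` on
the two standard reflections. -/
def dihedralCharacter (b : ZMod 2) : DihedralGroup 4 →* Multiplicative (ZMod 2) where
  toFun
    | .r i => Multiplicative.ofAdd (i.val : ZMod 2)
    | .sr i => Multiplicative.ofAdd (i.val + 1 + b : ZMod 2)
  map_one' := rfl
  map_mul' := by revert b; decide

/-- Only the two rotations of order four take the value 1 under both characters. -/
theorem dihedral_sq_ne_one : ∀ g : DihedralGroup 4, dihedralCharacter 0 g = Multiplicative.ofAdd 1 →
    dihedralCharacter 1 g = Multiplicative.ofAdd 1 → g ^ 2 ≠ 1 := by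
  decide

/-- The parity vector of an involution is clique supported. -/
theorem cliqueSupported_parity {x : Γ.RightAngledCoxeterGroup} (hx : x ^ 2 = 1) :
    Γ.CliqueSupported (parity x) := by
  classical
  intro v hv w hw hvw
  by_contra hadj
  -- Killing all other vertices is consistent because the nonadjacent `v` and `w` need not commute;
  -- the two characters then read off the parities at `v` and `w`.
  let F : Γ.RightAngledCoxeterGroup →* DihedralGroup 4 :=
    lift (fun u => if u = v then .sr 0 else if u = w then .sr 1 else 1)
      (fun u => by split_ifs <;> decide) (fun a b hab => by
        by_cases hav : a = v <;> by_cases haw : a = w <;> by_cases hbv : b = v <;>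
          by_cases hbw : b = w <;> subst_vars <;>
          simp_all [Commute.one_left, Commute.one_right, Γ.adj_comm])
  have h0 : (dihedralCharacter 0).comp F =
      (AddMonoidHom.toMultiplicative (Pi.evalAddMonoidHom (fun _ : V => ZMod 2) v)).comp
        (parityHom Γ) := by
    refine hom_ext fun u => ?_
    simp only [MonoidHom.comp_apply, F, lift_of, parityHom]
    by_cases h1 : u = v
    · subst h1
      simp
      rfl
    · by_cases h2 : u = w
      · subst h2
        simp [h1, Ne.symm h1]
        rfl
      · simp [h1, h2, Ne.symm h1]
  have h1 : (dihedralCharacter 1).comp F =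
      (AddMonoidHom.toMultiplicative (Pi.evalAddMonoidHom (fun _ : V => ZMod 2) w)).comp
        (parityHom Γ) := by
    refine hom_ext fun u => ?_
    simp only [MonoidHom.comp_apply, F, lift_of, parityHom]
    by_cases h1 : u = v
    · subst h1
      simp [Ne.symm hvw]
      rfl
    · by_cases h2 : u = w
      · subst h2
        simp [h1]
        rfl
      · simp [h1, h2, Ne.symm h2]
  have eq_one : ∀ a : ZMod 2, a ≠ 0 → a = 1 := by decide
  refine dihedral_sq_ne_one (F x) ?_ ?_ (by rw [← map_pow, hx, map_one])
  · exact (DFunLike.congr_fun h0 x).trans (congrArg Multiplicative.ofAdd (eq_one _ hv))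
  · exact (DFunLike.congr_fun h1 x).trans (congrArg Multiplicative.ofAdd (eq_one _ hw))

/-- Every clique supported vector is the parity vector of an involution. -/
theorem CliqueSupported.exists_parity_eq [Finite V] {u : V → ZMod 2} (hu : Γ.CliqueSupported u) :
    ∃ x : Γ.RightAngledCoxeterGroup, x ^ 2 = 1 ∧ parity x = u := by
  classical
  have := Fintype.ofFinite V
  -- The commutation clause lets the next generator be multiplied on without losing `x ^ 2 = 1`.
  suffices H : ∀ s : Finset V, Γ.IsClique (s : Set V) → ∃ x : Γ.RightAngledCoxeterGroup,
      x ^ 2 = 1 ∧ (∀ v, (∀ w ∈ s, Γ.Adj v w) → Commute (of Γ v) x) ∧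
        parity x = fun v => if v ∈ s then 1 else 0 by
    obtain ⟨x, hx, -, hp⟩ := H {v | u v ≠ 0} 
      (by simpa [CliqueSupported, Function.support] using hu)
    refine ⟨x, hx, hp.trans (funext fun v => ?_)⟩
    have : ∀ a : ZMod 2, (if a ≠ 0 then 1 else 0) = a := by decide
    simpa using this (u v)
  intro s
  induction s using Finset.induction_on with
  | empty => exact fun _ => ⟨1, one_pow 2, fun _ _ => Commute.one_right _, by simp; rfl⟩
  | insert a s ha ih =>
    intro hs
    rw [Finset.coe_insert, isClique_insert_of_notMem (by simpa using ha)] at hs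
    obtain ⟨x, hx, hc, hp⟩ := ih hs.1
    refine ⟨of Γ a * x, ?_, fun v hv => ?_, ?_⟩
    · rw [(hc a fun w hw => hs.2 w hw).mul_pow, of_sq, hx, one_mul]
    · exact (commute_of (hv a (Finset.mem_insert_self a s))).mul_right
        (hc v fun w hw => hv w (Finset.mem_insert_of_mem hw))
    · rw [parity_mul, parity_of, hp]
      ext v
      by_cases h : v = a
      · subst h
        simp [ha]
      · simp [h]

/-- A homomorphism of right-angled Coxeter groups induces a linear map on parity vectors. -/
theorem exists_linearMap_parity [Finite V]
    (φ : Γ.RightAngledCoxeterGroup →* Λ.RightAngledCoxeterGroup) :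
    ∃ L : (V → ZMod 2) →ₗ[ZMod 2] (V' → ZMod 2), ∀ x, L (parity x) = parity (φ x) := by
  classical
  have := Fintype.ofFinite V
  let L := (Pi.basisFun (ZMod 2) V).constr (ZMod 2) fun v => parity (φ (of Γ v))
  refine ⟨L, fun x => ?_⟩
  have h : L.toAddMonoidHom.toMultiplicative.comp (parityHom Γ) = (parityHom Λ).comp φ := by
    refine hom_ext fun v => ?_
    have : L (parity (of Γ v)) = parity (φ (of Γ v)) := by
      rw [parity_of, ← Pi.basisFun_apply, Module.Basis.constr_basis]
    exact this
  exact DFunLike.congr_fun h x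

/-- A linear map that fixes all parity vectors is the identity. -/
theorem linearMap_eq_id_of_parity [Finite V] (Γ : SimpleGraph V)
    {N : (V → ZMod 2) →ₗ[ZMod 2] (V → ZMod 2)}
    (hN : ∀ x : Γ.RightAngledCoxeterGroup, N (parity x) = parity x) : N = LinearMap.id := by
  classical
  refine LinearMap.pi_ext' fun v => LinearMap.ext_ring ?_
  simpa using hN (of Γ v)

/-- An isomorphism of right-angled Coxeter groups induces a linear equivalence that preserves
the clique supported vectors. -/
theorem exists_linearEquiv_cliqueSupported [Finite V] [Finite V']
    (φ : Γ.RightAngledCoxeterGroup ≃* Λ.RightAngledCoxeterGroup) :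
    ∃ L : (V → ZMod 2) ≃ₗ[ZMod 2] (V' → ZMod 2),
      ∀ u, Λ.CliqueSupported (L u) ↔ Γ.CliqueSupported u := by
  classical
  obtain ⟨L, hL⟩ := exists_linearMap_parity φ.toMonoidHom
  obtain ⟨M, hM⟩ := exists_linearMap_parity φ.symm.toMonoidHom
  have h1 : L ∘ₗ M = LinearMap.id := linearMap_eq_id_of_parity Λ fun x => by
    rw [LinearMap.comp_apply, hM, hL]
    exact congrArg parity (φ.apply_symm_apply x)
  have h2 : M ∘ₗ L = LinearMap.id := linearMap_eq_id_of_parity Γ fun x => by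
    rw [LinearMap.comp_apply, hL, hM]
    exact congrArg parity (φ.symm_apply_apply x)
  refine ⟨LinearEquiv.ofLinearMap L M h1 h2, fun u => ⟨fun h => ?_, fun h => ?_⟩⟩
  · obtain ⟨x, hx, hp⟩ := h.exists_parity_eq
    have : u = parity (φ.symm x) := by
      have := hM x
      rw [hp] at this
      exact (DFunLike.congr_fun h2 u).symm.trans this
    rw [this]
    exact cliqueSupported_parity (by rw [← map_pow, hx, map_one])
  · obtain ⟨x, hx, rfl⟩ := h.exists_parity_eq
    rw [LinearEquiv.coe_ofLinearMap, hL]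
    exact cliqueSupported_parity (by rw [← map_pow, hx, map_one])

/-! ### Clique subspaces. -/

/-- A subspace of clique supported vectors. -/
def IsCliqueSubspace (Γ : SimpleGraph V) (U : Submodule (ZMod 2) (V → ZMod 2)) : Prop :=
  ∀ u ∈ U, Γ.CliqueSupported u

/-- The union of the supports of the vectors of a clique subspace is a clique. -/
theorem IsCliqueSubspace.adj {U : Submodule (ZMod 2) (V → ZMod 2)} (hU : Γ.IsCliqueSubspace U)
    {u u' : V → ZMod 2} (hu : u ∈ U) (hu' : u' ∈ U) {v w : V} (hv : u v ≠ 0) (hw : u' w ≠ 0)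
    (hvw : v ≠ w) : Γ.Adj v w := by
  by_cases h1 : u w = 0
  · by_cases h2 : u' v = 0
    -- Neither vector is nonzero at both vertices, but the sum is.
    · exact hU _ (U.add_mem hu hu') (by simpa [h2] using hv) (by simpa [h1] using hw) hvw
    · exact hU _ hu' h2 hw hvw
  · exact hU _ hu hv h1 hvw

/-- The coordinate subspace of vectors supported on a set. -/
def coordinateSubspace (K : Set V) : Submodule (ZMod 2) (V → ZMod 2) where
  carrier := {u | Function.support u ⊆ K}
  zero_mem' := by simp
  add_mem' hu hv := (Function.support_add _ _).trans (Set.union_subset hu hv)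
  smul_mem' c u hu := (Function.support_const_smul_subset c u).trans hu

theorem isCliqueSubspace_coordinateSubspace {K : Set V} (hK : Γ.IsClique K) :
    Γ.IsCliqueSubspace (coordinateSubspace K) :=
  fun _ hu => hK.subset hu

/-- The union `K` of all supports is a clique, so by maximality `U` is the whole coordinate subspace
on `K`. -/
theorem single_mem_of_maximal [DecidableEq V] {U : Submodule (ZMod 2) (V → ZMod 2)}
    (hU : Maximal Γ.IsCliqueSubspace U) {u : V → ZMod 2} (hu : u ∈ U) {v : V} (hv : u v ≠ 0) :
    Pi.single v 1 ∈ U := by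
  let K : Set V := {w | ∃ t ∈ U, t w ≠ 0}
  have hK : Γ.IsClique K := fun a ⟨s, hs, ha⟩ b ⟨t, ht, hb⟩ hab => hU.1.adj hs ht ha hb hab
  have hUK : U ≤ coordinateSubspace K := fun t ht w hw => ⟨t, ht, hw⟩
  refine hU.2 (isCliqueSubspace_coordinateSubspace hK) hUK ?_
  intro w hw
  obtain rfl : w = v := by
    by_contra h
    simp [h] at hw
  exact ⟨u, hu, hv⟩

theorem adj_iff_exists_maximal [Finite V] [DecidableEq V] {v w : V} :
    Γ.Adj v w ↔ v ≠ w ∧ ∃ U, Maximal Γ.IsCliqueSubspace U ∧ Pi.single v 1 ∈ U ∧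
      Pi.single w 1 ∈ U := by
  constructor
  · intro h
    obtain ⟨U, hle, hU⟩ := (Set.toFinite {U | Γ.IsCliqueSubspace U}).exists_le_maximal
      (isCliqueSubspace_coordinateSubspace (isClique_pair.2 fun _ => h) :
        Γ.IsCliqueSubspace (coordinateSubspace {v, w}))
    refine ⟨h.ne, U, hU, hle ?_, hle ?_⟩
    all_goals
      intro a ha
      by_contra h'
      simp_all
  · rintro ⟨hne, U, hU, hv, hw⟩
    exact hU.1.adj hv hw (by simp) (by simp) hne

/-- The dimension of a subspace spanned by standard basis vectors. -/
theorem finrank_eq_card_single_mem {k : Type*} [Field k] [Finite V] [DecidableEq V]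
    {U : Submodule k (V → k)} (hU : ∀ u ∈ U, ∀ v, u v ≠ 0 → Pi.single v 1 ∈ U) :
    Module.finrank k U = Nat.card {v : V // Pi.single v 1 ∈ U} := by
  have := Fintype.ofFinite V
  have := Fintype.ofFinite {v : V // (Pi.single v 1 : V → k) ∈ U}
  have hli : LinearIndependent k
      fun v : {v : V // (Pi.single v 1 : V → k) ∈ U} => (Pi.single v.1 1 : V → k) := by
    have := (Pi.basisFun k V).linearIndependent.comp
      (Subtype.val : {v : V // (Pi.single v 1 : V → k) ∈ U} → V) Subtype.val_injective
    simpa [Function.comp_def] using this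
  have hspan : Submodule.span k (Set.range
      fun v : {v : V // (Pi.single v 1 : V → k) ∈ U} => (Pi.single v.1 1 : V → k)) = U := by
    refine le_antisymm (Submodule.span_le.2 ?_) fun u hu => ?_
    · rintro _ ⟨v, rfl⟩
      exact v.2
    · rw [← Finset.univ_sum_single u]
      refine Submodule.sum_mem _ fun v _ => ?_
      by_cases h : u v = 0
      · simp [h]
      · have : (Pi.single v (u v) : V → k) = u v • Pi.single v 1 := by
          rw [← Pi.single_smul, smul_eq_mul, mul_one]
        rw [this]
        exact Submodule.smul_mem _ _ (Submodule.subset_span ⟨⟨v, hU u hu v h⟩, rfl⟩)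
  rw [Nat.card_eq_fintype_card, ← finrank_span_eq_card hli, hspan]

end SimpleGraph

/-! ### Recovering the vertices by counting. -/

/-- The number of points where a function is at least `a`, counted by values. -/
theorem card_le_eq_sum_card_fiber {V α : Type*} [Finite V] [Fintype α] [PartialOrder α]
    [DecidableLT α] (f : V → α) (a : α) :
    Nat.card {v // a ≤ f v} =
      Nat.card {v // f v = a} + ∑ b with a < b, Nat.card {v // f v = b} := by
  classical
  have := Fintype.ofFinite V
  simp only [Nat.card_eq_fintype_card, Fintype.card_subtype]
  have hsum : ∑ b with a < b, Finset.card {v | f v = b} = Finset.card {v | a < f v} := by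
    rw [Finset.card_eq_sum_card_fiberwise (f := f) (t := Finset.univ.filter (a < ·))
      (fun v hv => by simpa using hv)]
    refine Finset.sum_congr rfl fun b hb => congrArg Finset.card ?_
    ext v
    simp only [Finset.mem_filter, Finset.mem_univ, true_and] at hb ⊢
    exact ⟨fun h => ⟨h ▸ hb, h⟩, fun h => h.2⟩
  rw [hsum, ← Finset.card_union_of_disjoint
    (Finset.disjoint_filter.2 fun v _ h => by simp [h])]
  congr 1
  ext v
  simp [le_iff_lt_or_eq, or_comm, eq_comm]

/-- Two functions from finite types to a finite partial order agree up to a bijection of their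
domains if they take values above each element equally often. -/
theorem exists_equiv_of_card_le_eq {V V' α : Type*} [Finite V] [Finite V'] [Finite α]
    [PartialOrder α] (f : V → α) (g : V' → α)
    (h : ∀ a, Nat.card {v // a ≤ f v} = Nat.card {v // a ≤ g v}) :
    ∃ e : V ≃ V', ∀ v, g (e v) = f v := by
  classical
  have := Fintype.ofFinite α
  have key : ∀ a, Nat.card {v // f v = a} = Nat.card {v // g v = a} := by
    intro a
    -- Descending induction: fibres over larger values already agree and cancel.
    induction a using WellFoundedGT.induction with
    | ind a ih =>
      have hsum := h a
      rw [card_le_eq_sum_card_fiber, card_le_eq_sum_card_fiber,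
        Finset.sum_congr rfl fun b hb => ih b (Finset.mem_filter.1 hb).2] at hsum
      exact Nat.add_right_cancel hsum
  have F : ∀ a, {v // f v = a} ≃ {v // g v = a} := fun a => (Finite.card_eq.1 (key a)).some
  exact ⟨Equiv.ofFiberEquiv F, Equiv.ofFiberEquiv_map F⟩

namespace SimpleGraph

/-- A linear equivalence that preserves the clique supported vectors yields a bijection of the
vertices that preserves membership of the standard basis vectors in maximal clique subspaces. -/
theorem exists_equiv_single_mem_iff {V V' : Type*} [Finite V] [Finite V'] [DecidableEq V]
    [DecidableEq V'] {Γ : SimpleGraph V} {Λ : SimpleGraph V'}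
    (L : Submodule (ZMod 2) (V → ZMod 2) ≃o Submodule (ZMod 2) (V' → ZMod 2))
    (hrank : ∀ U, Module.finrank (ZMod 2) (L U) = Module.finrank (ZMod 2) U)
    (hL : ∀ U, Maximal Λ.IsCliqueSubspace (L U) ↔ Maximal Γ.IsCliqueSubspace U) :
    ∃ e : V ≃ V', ∀ U, Maximal Γ.IsCliqueSubspace U → ∀ v,
      (Pi.single (e v) 1 ∈ L U ↔ Pi.single v 1 ∈ U) := by
  let α := Set {U // Maximal Γ.IsCliqueSubspace U}
  let f : V → α := fun v => {U | Pi.single v 1 ∈ U.1}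
  let g : V' → α := fun v => {U | Pi.single v 1 ∈ L U.1}
  obtain ⟨e, he⟩ := exists_equiv_of_card_le_eq f g fun S => by
    -- The vertices lying in every member of `S` number `dim T`, and `L` preserves intersections and
    -- dimension.
    let T : Submodule (ZMod 2) (V → ZMod 2) := ⨅ U ∈ S, U.1
    have hT : ∀ v, S ≤ f v ↔ Pi.single v 1 ∈ T := fun v => by
      simp only [T, Submodule.mem_iInf]
      rfl
    have hLT : ∀ v, S ≤ g v ↔ Pi.single v 1 ∈ L T := fun v => by
      simp only [T, OrderIso.map_iInf, Submodule.mem_iInf]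
      rfl
    simp only [hT, hLT]
    rw [← finrank_eq_card_single_mem, ← finrank_eq_card_single_mem, hrank]
    · intro u hu v hv
      simp only [T, OrderIso.map_iInf, Submodule.mem_iInf] at hu ⊢
      exact fun U hU => single_mem_of_maximal ((hL _).2 U.2) (hu U hU) hv
    · intro u hu v hv
      simp only [T, Submodule.mem_iInf] at hu ⊢
      exact fun U hU => single_mem_of_maximal U.2 (hu U hU) hv
  exact ⟨e, fun U hU v => Set.ext_iff.1 (he v) ⟨U, hU⟩⟩

end SimpleGraph

theorem mainTheorem4 {V V' : Type*} [Finite V] [Finite V']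
    (Γ : SimpleGraph V) (Λ : SimpleGraph V')
    (h : Nonempty (Γ.RightAngledCoxeterGroup ≃* Λ.RightAngledCoxeterGroup)) :
    Nonempty (Γ ≃g Λ) := by
  classical
  obtain ⟨φ⟩ := h
  obtain ⟨L, hL⟩ := SimpleGraph.exists_linearEquiv_cliqueSupported φ
  let E := Submodule.orderIsoMapComap L
  have hclique : ∀ U, Λ.IsCliqueSubspace (E U) ↔ Γ.IsCliqueSubspace U := fun U => by
    simp [E, SimpleGraph.IsCliqueSubspace, L.symm.forall_congr_left, hL]
  have hmax : ∀ U, Maximal Λ.IsCliqueSubspace (E U) ↔ Maximal Γ.IsCliqueSubspace U := fun U => by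
    refine ⟨fun h => ⟨(hclique U).1 h.1, fun T hT hUT => ?_⟩,
      fun h => ⟨(hclique U).2 h.1, fun T hT hUT => ?_⟩⟩
    · exact E.le_iff_le.1 (h.2 ((hclique T).2 hT) (E.le_iff_le.2 hUT))
    · obtain ⟨T, rfl⟩ := E.surjective T
      exact E.le_iff_le.2 (h.2 ((hclique T).1 hT) (E.le_iff_le.1 hUT))
  obtain ⟨e, he⟩ := SimpleGraph.exists_equiv_single_mem_iff E
    (fun U => LinearEquiv.finrank_map_eq L U) hmax
  refine ⟨⟨e, fun {v w} => ?_⟩⟩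
  rw [SimpleGraph.adj_iff_exists_maximal, SimpleGraph.adj_iff_exists_maximal, e.injective.ne_iff]
  refine and_congr_right fun _ => ⟨?_, ?_⟩
  · rintro ⟨U, hU, hv, hw⟩
    obtain ⟨U, rfl⟩ := E.surjective U
    rw [hmax] at hU
    exact ⟨U, hU, (he U hU v).1 hv, (he U hU w).1 hw⟩
  · rintro ⟨U, hU, hv, hw⟩
    exact ⟨E U, (hmax U).2 hU, (he U hU v).2 hv, (he U hU w).2 hw⟩
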